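/- Let $N\ge 1$, $0<s<1$, $p>1$, and let $\Omega\subset\mathbb{R}^N$ be a bounded domain. For measurable $u:\mathbb{R}^N\to\mathbb{R}$ put $$[u]_{s,p}=\Big(\int_{\mathbb{R}^{2N}}\frac{|u(x)-u(y)|^p}{|x-y|^{N+sp}}\,dx\,dy\Big)^{1/p},\qquad J_u(x,y)=|u(x)-u(y)|^{p-2}(u(x)-u(y)),$$ with $J_u(x,y)=0$ when $u(x)=u(y)$, and let $$W_0^{s,p}(\Omega)=\{u\in L^p(\mathbb{R}^N): [u]_{s,p}<\infty,\ u=0 \text{ a.e. in } \mathbb{R}^N\setminus\Omega\}.$$ For a function $g$ on $\Omega$, write $g\in W_0^{s,p}(\Omega)^*$ if there is a constant $C$ such that, for every $v\in W_0^{s,p}(\Omega)$, $gv\in L^1(\Omega)$ and $\big|\int_\Omega gv\,dx\big|\le C[v]_{s,p}$. Let $g\in W_0^{s,p}(\Omega)^*\cap L^1(\Omega)$ and let $u\in W_0^{s,p}(\Omega)$ be a weak solution of $(-\Delta)_p^s u=g$ in $\Omega$, $u=0$ in $\mathbb{R}^N\setminus\Omega$, that is, $$\int_{\mathbb{R}^{2N}}\frac{J_u(x,y)\,(v(x)-v(y))}{|x-y|^{N+sp}}\,dx\,dy=\int_\Omega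 g v\,dx\qquad\text{for all } v\in W_0^{s,p}(\Omega),\ v\ge 0.$$ Then $|u|\in W_0^{s,p}(\Omega)$ and $(-\Delta)_p^s|u|\le |g|$ holds weakly: for all $\psi\in W_0^{s,p}(\Omega)\cap L^\infty(\mathbb{R}^N)$ with $\psi\ge 0$, $$\int_{\mathbb{R}^{2N}}\frac{J_{|u|}(x,y)\,(\psi(x)-\psi(y))}{|x-y|^{N+sp}}\,dx\,dy\le\int_\Omega |g|\,\psi\,dx,$$ where both integrals converge absolutely. -/

import Mathlib

open MeasureTheory
open scoped ENNReal

/-- The `p`-th power `[u]_{s,p}^p` of the Gagliardo seminorm, as an extended nonnegative number: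
the integral of `|u(x) - u(y)|^p / |x - y|^(N + s p)` over `ℝ^N × ℝ^N`. -/
noncomputable def gagliardoPow {N : ℕ} (s p : ℝ) (u : EuclideanSpace ℝ (Fin N) → ℝ) : ℝ≥0∞ :=
  ∫⁻ z : EuclideanSpace ℝ (Fin N) × EuclideanSpace ℝ (Fin N),
    ENNReal.ofReal (|u z.1 - u z.2| ^ p / ‖z.1 - z.2‖ ^ ((N : ℝ) + s * p))

/-- The Gagliardo seminorm `[u]_{s,p}`, meaningful when `gagliardoPow s p u < ∞`. -/
noncomputable def gagliardoSeminorm {N : ℕ} (s p : ℝ) (u : EuclideanSpace ℝ (Fin N) → ℝ) : ℝ :=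
  (gagliardoPow s p u).toReal ^ (1 / p)

/-- `u ∈ W^{s,p}(ℝ^N)`: `u ∈ L^p(ℝ^N)` and `[u]_{s,p} < ∞`. -/
def MemFracSobolev {N : ℕ} (s p : ℝ) (u : EuclideanSpace ℝ (Fin N) → ℝ) : Prop :=
  MemLp u (ENNReal.ofReal p) volume ∧ gagliardoPow s p u < ∞

/-- `u ∈ W_0^{s,p}(Ω)`: `u ∈ W^{s,p}(ℝ^N)` and `u = 0` a.e. in `ℝ^N \ Ω`. -/
def MemFracSobolevZero {N : ℕ} (s p : ℝ) (Ω : Set (EuclideanSpace ℝ (Fin N)))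
    (u : EuclideanSpace ℝ (Fin N) → ℝ) : Prop :=
  MemFracSobolev s p u ∧ ∀ᵐ x ∂volume, x ∉ Ω → u x = 0

/-- `J_w(x,y) = |w(x) - w(y)|^(p-2) (w(x) - w(y))` (it is `0` when `w(x) = w(y)`). -/
noncomputable def fracJ {N : ℕ} (p : ℝ) (w : EuclideanSpace ℝ (Fin N) → ℝ)
    (x y : EuclideanSpace ℝ (Fin N)) : ℝ :=
  |w x - w y| ^ (p - 2) * (w x - w y)

/-- The integrand `J_u(x,y) (v(x) - v(y)) / |x - y|^(N + s p)`. -/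
noncomputable def fracPLaplaceIntegrand {N : ℕ} (s p : ℝ) (u v : EuclideanSpace ℝ (Fin N) → ℝ)
    (z : EuclideanSpace ℝ (Fin N) × EuclideanSpace ℝ (Fin N)) : ℝ :=
  fracJ p u z.1 z.2 * (v z.1 - v z.2) / ‖z.1 - z.2‖ ^ ((N : ℝ) + s * p)

/-- The pairing `⟨(-Δ)_p^s u, v⟩`. -/
noncomputable def fracPLaplace {N : ℕ} (s p : ℝ) (u v : EuclideanSpace ℝ (Fin N) → ℝ) : ℝ :=
  ∫ z : EuclideanSpace ℝ (Fin N) × EuclideanSpace ℝ (Fin N), fracPLaplaceIntegrand s p u v z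

/-- `g ∈ W_0^{s,p}(Ω)^*`: for every `v ∈ W_0^{s,p}(Ω)` one has `g v ∈ L^1(Ω)`, and
`|∫_Ω g v| ≤ C [v]_{s,p}` with `C` independent of `v`. Only `g` on `Ω` matters. -/
def MemFracSobolevDual {N : ℕ} (s p : ℝ) (Ω : Set (EuclideanSpace ℝ (Fin N)))
    (g : EuclideanSpace ℝ (Fin N) → ℝ) : Prop :=
  ∃ C : ℝ, ∀ v : EuclideanSpace ℝ (Fin N) → ℝ, MemFracSobolevZero s p Ω v →
    IntegrableOn (fun x => g x * v x) Ω volume ∧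
      |∫ x in Ω, g x * v x| ≤ C * gagliardoSeminorm s p v

/-- `u` is a weak solution of `(-Δ)_p^s u = g` in `Ω`, `u = 0` in `ℝ^N \ Ω`. -/
def IsFracPLaplaceWeakSolution {N : ℕ} (s p : ℝ) (Ω : Set (EuclideanSpace ℝ (Fin N)))
    (g u : EuclideanSpace ℝ (Fin N) → ℝ) : Prop :=
  MemFracSobolevZero s p Ω u ∧ MemFracSobolevDual s p Ω g ∧
    ∀ v : EuclideanSpace ℝ (Fin N) → ℝ, MemFracSobolevZero s p Ω v →
      (∀ᵐ x ∂volume, 0 ≤ v x) → fracPLaplace s p u v = ∫ x in Ω, g x * v x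

/-!
The inequality is a nonlinear form of Kato's inequality, obtained by testing the equation for `u`
with `ψ` times a regularized sign of `u`.

Let `σₙ(t) = min 1 (n t)⁺ - min 1 (-n t)⁺` (`regSign`), a nondecreasing Lipschitz function with
values in `[-1, 1]` that for each `t` is eventually equal to `sign t`. As `ψ` is bounded, `vₙ = ψ σₙ(u)` is a
difference of two nonnegative elements of `W_0^{s,p}(Ω)` (`MemFracSobolevZero.mul_comp_lipschitz`),
so that `⟨(-Δ)_p^s u, vₙ⟩ = ∫_Ω g vₙ ≤ ∫_Ω |g| ψ`.

It remains to compare `⟨(-Δ)_p^s u, vₙ⟩` with `⟨(-Δ)_p^s |u|, ψ⟩`. Write `J(t) = |t|^(p-2) t`. The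
monotonicity of `J` yields, for `α, β ≥ 0`, `J(|a| - |b|)(α - β) ≤ J(a - b)(α sign a - β sign b)`
(`signedPow_abs_sub_abs_mul_le`), hence the integrand for `(|u|, ψ)` is pointwise at most the one
for `(u, vₙ)` as soon as `n` is large. The threshold depends on the point, and the integrands for
`(u, vₙ)` need not have a common integrable majorant; but they have a common integrable minorant,
because `J(a - b)(σₙ(a) - σₙ(b)) ≥ 0` (`neg_le_signedPow_mul_sub`). The minimum of the two
integrands is therefore dominated, converges to the integrand for `(|u|, ψ)`, and has an integral
of at most `∫_Ω |g| ψ`.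
-/

/-! ### The signed power -/

/-- The odd power `|t|^(p-2) t`, so that `fracJ p w x y = signedPow p (w x - w y)`. -/
noncomputable def signedPow (p t : ℝ) : ℝ := |t| ^ (p - 2) * t

lemma abs_signedPow {p : ℝ} (hp : 1 < p) (t : ℝ) : |signedPow p t| = |t| ^ (p - 1) := by
  rcases eq_or_ne t 0 with rfl | ht
  · simp [signedPow, Real.zero_rpow (sub_pos.2 hp).ne']
  · have h := abs_pos.2 ht
    rw [signedPow, abs_mul, abs_of_nonneg (Real.rpow_nonneg (abs_nonneg t) _)]
    nth_rewrite 2 [← Real.rpow_one |t|]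
    rw [← Real.rpow_add h]
    ring_nf

lemma signedPow_neg (p t : ℝ) : signedPow p (-t) = -signedPow p t := by
  simp [signedPow]

lemma signedPow_nonneg (p : ℝ) {t : ℝ} (ht : 0 ≤ t) : 0 ≤ signedPow p t :=
  mul_nonneg (Real.rpow_nonneg (abs_nonneg t) _) ht

lemma abs_signedPow_le {p : ℝ} (hp : 1 < p) {r t : ℝ} (h : |r| ≤ |t|) :
    |signedPow p r| ≤ |signedPow p t| := by
  rw [abs_signedPow hp, abs_signedPow hp]
  exact Real.rpow_le_rpow (abs_nonneg r) h (sub_pos.2 hp).le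

lemma abs_signedPow_mul_le {p : ℝ} (hp : 1 < p) (a b : ℝ) :
    |signedPow p a| * |b| ≤ |a| ^ p + |b| ^ p := by
  have hp1 : 0 ≤ p - 1 := (sub_pos.2 hp).le
  have key : ∀ t : ℝ, 0 ≤ t → t ^ (p - 1) * t = t ^ p := fun t ht => by
    nth_rewrite 2 [← Real.rpow_one t]
    rw [← Real.rpow_add_of_nonneg ht hp1 zero_le_one]
    ring_nf
  rw [abs_signedPow hp]
  have ha := Real.rpow_nonneg (abs_nonneg a) p
  have hb := Real.rpow_nonneg (abs_nonneg b) p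
  rcases le_total |a| |b| with h | h
  · have := mul_le_mul_of_nonneg_right (Real.rpow_le_rpow (abs_nonneg a) h hp1) (abs_nonneg b)
    rw [key _ (abs_nonneg b)] at this
    linarith
  · have := mul_le_mul_of_nonneg_left h (Real.rpow_nonneg (abs_nonneg a) (p - 1))
    rw [key _ (abs_nonneg a)] at this
    linarith

lemma signedPow_mul_sub_nonneg (p : ℝ) {f : ℝ → ℝ} (hf : Monotone f) (a b : ℝ) :
    0 ≤ signedPow p (a - b) * (f a - f b) := by
  rcases le_total b a with h | h
  · exact mul_nonneg (signedPow_nonneg p (sub_nonneg.2 h)) (sub_nonneg.2 (hf h))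
  · rw [← neg_sub b a, signedPow_neg, neg_mul, ← mul_neg, neg_sub]
    exact mul_nonneg (signedPow_nonneg p (sub_nonneg.2 h)) (sub_nonneg.2 (hf h))

/-- Multiplying by a monotone function of `a`, `b` with values in `[-1, 1]` decreases the product
with `α - β` by a controlled amount only: split
`α f(a) - β f(b) = (α - β) f(a) + β (f(a) - f(b))`. -/
lemma neg_le_signedPow_mul_sub (p : ℝ) {f : ℝ → ℝ} (hf : Monotone f) (hf1 : ∀ t, |f t| ≤ 1)
    (a b α : ℝ) {β : ℝ} (hβ : 0 ≤ β) :
    -(|signedPow p (a - b)| * |α - β|) ≤ signedPow p (a - b) * (α * f a - β * f b) := by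
  have h1 : |signedPow p (a - b) * (α - β) * f a| ≤ |signedPow p (a - b)| * |α - β| := by
    rw [abs_mul, abs_mul]
    exact mul_le_of_le_one_right (by positivity) (hf1 a)
  have h2 := mul_nonneg hβ (signedPow_mul_sub_nonneg p hf a b)
  have h3 := neg_abs_le (signedPow p (a - b) * (α - β) * f a)
  linarith

/-- The pointwise Kato inequality: the signed power of `|a| - |b|` is compared with that of `a - b`
at the price of multiplying the weights `α`, `β` by the signs of `a`, `b`. -/
lemma signedPow_abs_sub_abs_mul_le {p : ℝ} (hp : 1 < p) (a b : ℝ) {α β : ℝ} (hα : 0 ≤ α)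
    (hβ : 0 ≤ β) :
    signedPow p (|a| - |b|) * (α - β) ≤
      signedPow p (a - b) * (α * Real.sign a - β * Real.sign b) := by
  have hmono := abs_signedPow_le hp (abs_abs_sub_abs_le_abs_sub a b)
  have hle : signedPow p (|a| - |b|) * (α - β) ≤ |signedPow p (a - b)| * (α + β) := by
    refine (le_abs_self _).trans ?_
    rw [abs_mul]
    exact mul_le_mul hmono (abs_le.2 ⟨by linarith, by linarith⟩) (abs_nonneg _) (abs_nonneg _)
  have hJ0 : signedPow p 0 = 0 := by simp [signedPow]
  rcases lt_trichotomy a 0 with ha | rfl | ha <;> rcases lt_trichotomy b 0 with hb | rfl | hb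
  · rw [abs_of_neg ha, abs_of_neg hb, Real.sign_of_neg ha, Real.sign_of_neg hb,
      show -a - -b = -(a - b) by ring, signedPow_neg]
    linarith
  · rw [abs_of_neg ha, Real.sign_of_neg ha, Real.sign_zero, abs_zero, sub_zero, sub_zero,
      signedPow_neg]
    have := signedPow_nonneg p (neg_nonneg.2 ha.le)
    rw [signedPow_neg] at this
    nlinarith [mul_nonneg this hβ]
  · have := signedPow_nonneg p (show 0 ≤ -(a - b) by linarith)
    rw [signedPow_neg] at this
    rw [abs_of_nonpos (by linarith : signedPow p (a - b) ≤ 0)] at hle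
    rw [Real.sign_of_neg ha, Real.sign_of_pos hb]
    linarith
  · rw [abs_of_neg hb, Real.sign_of_neg hb, Real.sign_zero, abs_zero, zero_sub, zero_sub,
      neg_neg, signedPow_neg]
    have h0 := signedPow_nonneg p (neg_nonneg.2 hb.le)
    rw [signedPow_neg] at h0
    nlinarith [mul_nonneg h0 hα]
  · simp [hJ0]
  · rw [abs_of_pos hb, Real.sign_of_pos hb, Real.sign_zero, abs_zero, zero_sub, signedPow_neg]
    nlinarith [mul_nonneg (signedPow_nonneg p hb.le) hα]
  · have := signedPow_nonneg p (show 0 ≤ a - b by linarith)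
    rw [abs_of_nonneg this] at hle
    rw [Real.sign_of_pos ha, Real.sign_of_neg hb]
    linarith
  · rw [abs_of_pos ha, Real.sign_of_pos ha, Real.sign_zero, abs_zero, sub_zero]
    nlinarith [mul_nonneg (signedPow_nonneg p ha.le) hβ]
  · rw [abs_of_pos ha, abs_of_pos hb, Real.sign_of_pos ha, Real.sign_of_pos hb]
    linarith

/-! ### The regularized sign -/

/-- The Lipschitz ramp `t ↦ min 1 (n t)⁺`, from `0` on `(-∞, 0]` to `1` on `[1/n, ∞)`. -/
noncomputable def unitRamp (n : ℕ) (t : ℝ) : ℝ := min 1 (max 0 (n * t))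

lemma unitRamp_nonneg (n : ℕ) (t : ℝ) : 0 ≤ unitRamp n t :=
  le_min zero_le_one (le_max_left _ _)

lemma unitRamp_le_one (n : ℕ) (t : ℝ) : unitRamp n t ≤ 1 := min_le_left _ _

lemma unitRamp_mono (n : ℕ) : Monotone (unitRamp n) := fun a b h => by
  unfold unitRamp
  gcongr

lemma unitRamp_of_nonpos (n : ℕ) {t : ℝ} (ht : t ≤ 0) : unitRamp n t = 0 := by
  rw [unitRamp, max_eq_left (mul_nonpos_of_nonneg_of_nonpos n.cast_nonneg ht)]
  simp

lemma eventually_unitRamp_eq_one {t : ℝ} (ht : 0 < t) :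
    ∀ᶠ n : ℕ in Filter.atTop, unitRamp n t = 1 := by
  filter_upwards [(tendsto_natCast_atTop_atTop (R := ℝ)).eventually_ge_atTop (1 / t)] with n hn
  have h : 1 ≤ (n : ℝ) * t := (div_le_iff₀ ht).1 hn
  rw [unitRamp, min_eq_left (h.trans (le_max_right _ _))]

lemma lipschitzWith_unitRamp (n : ℕ) : LipschitzWith n (unitRamp n) := by
  refine LipschitzWith.const_min (LipschitzWith.const_max ?_ 0) 1
  refine LipschitzWith.of_dist_le_mul fun a b => ?_
  rw [Real.dist_eq, Real.dist_eq, ← mul_sub, abs_mul, Nat.abs_cast, NNReal.coe_natCast]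

lemma abs_unitRamp_le_one (n : ℕ) (t : ℝ) : |unitRamp n t| ≤ 1 := by
  rw [abs_of_nonneg (unitRamp_nonneg n t)]
  exact unitRamp_le_one n t

lemma lipschitzWith_unitRamp_neg (n : ℕ) : LipschitzWith n fun t => unitRamp n (-t) := by
  have h := (lipschitzWith_unitRamp n).comp (LipschitzWith.id (α := ℝ)).neg
  rwa [mul_one] at h

/-- The odd function with values in `[-1, 1]` that approximates the sign. -/
noncomputable def regSign (n : ℕ) (t : ℝ) : ℝ := unitRamp n t - unitRamp n (-t)

lemma regSign_mono (n : ℕ) : Monotone (regSign n) := fun _ _ h =>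
  sub_le_sub (unitRamp_mono n h) (unitRamp_mono n (neg_le_neg h))

lemma lipschitzWith_regSign (n : ℕ) : LipschitzWith (n + n) (regSign n) :=
  (lipschitzWith_unitRamp n).sub (lipschitzWith_unitRamp_neg n)

lemma abs_regSign_le_one (n : ℕ) (t : ℝ) : |regSign n t| ≤ 1 :=
  abs_le.2 ⟨by unfold regSign; linarith [unitRamp_nonneg n t, unitRamp_le_one n (-t)],
    by unfold regSign; linarith [unitRamp_nonneg n (-t), unitRamp_le_one n t]⟩

lemma eventually_regSign_eq_sign (t : ℝ) :
    ∀ᶠ n : ℕ in Filter.atTop, regSign n t = Real.sign t := by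
  rcases lt_trichotomy t 0 with ht | rfl | ht
  · filter_upwards [eventually_unitRamp_eq_one (neg_pos.2 ht)] with n hn
    rw [regSign, hn, unitRamp_of_nonpos n ht.le, Real.sign_of_neg ht, zero_sub]
  · exact .of_forall fun n => by simp [regSign]
  · filter_upwards [eventually_unitRamp_eq_one ht] with n hn
    rw [regSign, hn, unitRamp_of_nonpos n (neg_nonpos.2 ht.le), Real.sign_of_pos ht, sub_zero]

/-! ### Integrability of difference quotients -/

section Integrability

variable {N : ℕ} {s p : ℝ}

/-- The integrand of `gagliardoPow`, as a real function. -/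
noncomputable def gagliardoIntegrand (s p : ℝ) (u : EuclideanSpace ℝ (Fin N) → ℝ)
    (z : EuclideanSpace ℝ (Fin N) × EuclideanSpace ℝ (Fin N)) : ℝ :=
  |u z.1 - u z.2| ^ p / ‖z.1 - z.2‖ ^ ((N : ℝ) + s * p)

lemma gagliardoIntegrand_nonneg (u : EuclideanSpace ℝ (Fin N) → ℝ)
    (z : EuclideanSpace ℝ (Fin N) × EuclideanSpace ℝ (Fin N)) :
    0 ≤ gagliardoIntegrand s p u z := by
  unfold gagliardoIntegrand
  positivity

lemma ae_prod_and {P : EuclideanSpace ℝ (Fin N) → Prop} (h : ∀ᵐ x ∂volume, P x) :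
    ∀ᵐ z : EuclideanSpace ℝ (Fin N) × EuclideanSpace ℝ (Fin N), P z.1 ∧ P z.2 :=
  (Measure.quasiMeasurePreserving_fst.ae h).and (Measure.quasiMeasurePreserving_snd.ae h)

lemma aemeasurable_sub_prod {u : EuclideanSpace ℝ (Fin N) → ℝ} (hu : AEMeasurable u) :
    AEMeasurable fun z : EuclideanSpace ℝ (Fin N) × EuclideanSpace ℝ (Fin N) =>
      u z.1 - u z.2 :=
  (hu.comp_quasiMeasurePreserving Measure.quasiMeasurePreserving_fst).sub
    (hu.comp_quasiMeasurePreserving Measure.quasiMeasurePreserving_snd)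

lemma measurable_norm_sub_rpow (r : ℝ) :
    Measurable fun z : EuclideanSpace ℝ (Fin N) × EuclideanSpace ℝ (Fin N) =>
      ‖z.1 - z.2‖ ^ r := by
  fun_prop

lemma aemeasurable_gagliardoIntegrand {u : EuclideanSpace ℝ (Fin N) → ℝ} (hu : AEMeasurable u) :
    AEMeasurable (gagliardoIntegrand s p u) := by
  have h := aemeasurable_sub_prod hu
  unfold gagliardoIntegrand
  exact (h.abs.pow_const p).div (measurable_norm_sub_rpow _).aemeasurable

lemma aemeasurable_fracPLaplaceIntegrand {u v : EuclideanSpace ℝ (Fin N) → ℝ}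
    (hu : AEMeasurable u) (hv : AEMeasurable v) :
    AEMeasurable (fracPLaplaceIntegrand s p u v) := by
  have h := aemeasurable_sub_prod hu
  unfold fracPLaplaceIntegrand fracJ
  exact (((h.abs.pow_const _).mul h).mul (aemeasurable_sub_prod hv)).div
    (measurable_norm_sub_rpow _).aemeasurable

lemma MemFracSobolev.aemeasurable {u : EuclideanSpace ℝ (Fin N) → ℝ}
    (hu : MemFracSobolev s p u) : AEMeasurable u :=
  hu.1.aestronglyMeasurable.aemeasurable

lemma MemFracSobolev.integrable_gagliardoIntegrand {u : EuclideanSpace ℝ (Fin N) → ℝ}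
    (hu : MemFracSobolev s p u) : Integrable (gagliardoIntegrand s p u) :=
  ⟨(aemeasurable_gagliardoIntegrand hu.aemeasurable).aestronglyMeasurable,
    (hasFiniteIntegral_iff_ofReal (.of_forall (gagliardoIntegrand_nonneg u))).2 hu.2⟩

lemma gagliardoPow_lt_top_of_le {u : EuclideanSpace ℝ (Fin N) → ℝ}
    {F : EuclideanSpace ℝ (Fin N) × EuclideanSpace ℝ (Fin N) → ℝ} (hF : Integrable F)
    (h : ∀ᵐ z, gagliardoIntegrand s p u z ≤ F z) : gagliardoPow s p u < ∞ := by
  refine lt_of_le_of_lt (lintegral_mono_ae ?_) hF.lintegral_lt_top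
  filter_upwards [h] with z hz using ENNReal.ofReal_le_ofReal hz

lemma fracPLaplaceIntegrand_eq (u v : EuclideanSpace ℝ (Fin N) → ℝ)
    (z : EuclideanSpace ℝ (Fin N) × EuclideanSpace ℝ (Fin N)) :
    fracPLaplaceIntegrand s p u v z =
      signedPow p (u z.1 - u z.2) * (v z.1 - v z.2) / ‖z.1 - z.2‖ ^ ((N : ℝ) + s * p) :=
  rfl

lemma abs_signedPow_mul_div_le (hp : 1 < p) (u v : EuclideanSpace ℝ (Fin N) → ℝ)
    (z : EuclideanSpace ℝ (Fin N) × EuclideanSpace ℝ (Fin N)) :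
    |signedPow p (u z.1 - u z.2)| * |v z.1 - v z.2| / ‖z.1 - z.2‖ ^ ((N : ℝ) + s * p) ≤
      gagliardoIntegrand s p u z + gagliardoIntegrand s p v z := by
  rw [gagliardoIntegrand, gagliardoIntegrand, ← add_div]
  gcongr
  exact abs_signedPow_mul_le hp _ _

lemma MemFracSobolev.integrable_fracPLaplaceIntegrand (hp : 1 < p)
    {u v : EuclideanSpace ℝ (Fin N) → ℝ} (hu : MemFracSobolev s p u)
    (hv : MemFracSobolev s p v) : Integrable (fracPLaplaceIntegrand s p u v) := by
  refine (hu.integrable_gagliardoIntegrand.add hv.integrable_gagliardoIntegrand).mono'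
    (aemeasurable_fracPLaplaceIntegrand hu.aemeasurable hv.aemeasurable).aestronglyMeasurable
    (.of_forall fun z => ?_)
  rw [fracPLaplaceIntegrand_eq, Real.norm_eq_abs, abs_div, abs_mul,
    abs_of_nonneg (Real.rpow_nonneg (norm_nonneg (z.1 - z.2)) _)]
  exact abs_signedPow_mul_div_le hp u v z

lemma fracPLaplace_sub (hp : 1 < p) {u v w : EuclideanSpace ℝ (Fin N) → ℝ}
    (hu : MemFracSobolev s p u) (hv : MemFracSobolev s p v) (hw : MemFracSobolev s p w) :
    fracPLaplace s p u (fun x => v x - w x) = fracPLaplace s p u v - fracPLaplace s p u w := by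
  unfold fracPLaplace
  rw [← integral_sub (hu.integrable_fracPLaplaceIntegrand hp hv)
    (hu.integrable_fracPLaplaceIntegrand hp hw)]
  congr with z
  simp only [fracPLaplaceIntegrand]
  ring

/-! ### Operations on `W_0^{s,p}` -/

lemma MemFracSobolevZero.abs (hp : 1 < p) {Ω : Set (EuclideanSpace ℝ (Fin N))}
    {u : EuclideanSpace ℝ (Fin N) → ℝ} (hu : MemFracSobolevZero s p Ω u) :
    MemFracSobolevZero s p Ω fun x => |u x| := by
  refine ⟨⟨hu.1.1.abs, gagliardoPow_lt_top_of_le hu.1.integrable_gagliardoIntegrand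
    (.of_forall fun z => ?_)⟩, ?_⟩
  · unfold gagliardoIntegrand
    gcongr ?_ ^ p / _
    exact abs_abs_sub_abs_le_abs_sub _ _
  · filter_upwards [hu.2] with x hx hxΩ
    rw [hx hxΩ, abs_zero]

/-- A bounded element of `W_0^{s,p}(Ω)` stays in this space when multiplied by a bounded Lipschitz
function of an element of `W^{s,p}`. -/
lemma MemFracSobolevZero.mul_comp_lipschitz (hp : 1 < p) {Ω : Set (EuclideanSpace ℝ (Fin N))}
    {u ψ : EuclideanSpace ℝ (Fin N) → ℝ} (hψ : MemFracSobolevZero s p Ω ψ)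
    (hψb : MemLp ψ ∞ volume) (hu : MemFracSobolev s p u)
    {f : ℝ → ℝ} {L : NNReal} (hf : LipschitzWith L f) (hf1 : ∀ t, |f t| ≤ 1) :
    MemFracSobolevZero s p Ω fun x => ψ x * f (u x) := by
  have hp0 : 0 ≤ p := by linarith
  have hmeas : AEMeasurable fun x => ψ x * f (u x) :=
    hψ.1.aemeasurable.mul (hf.continuous.measurable.comp_aemeasurable hu.aemeasurable)
  refine ⟨⟨?_, ?_⟩, ?_⟩
  · refine hψ.1.1.mono hmeas.aestronglyMeasurable (.of_forall fun x => ?_)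
    rw [norm_mul]
    exact mul_le_of_le_one_right (norm_nonneg _) (hf1 _)
  · obtain ⟨M, hM⟩ : ∃ M : ℝ, ∀ᵐ x ∂volume, |ψ x| ≤ M := by
      refine ⟨(eLpNormEssSup ψ volume).toReal, ?_⟩
      have hfin : eLpNormEssSup ψ volume ≠ ∞ := eLpNorm_exponent_top (f := ψ) ▸ hψb.2.ne
      filter_upwards [ae_le_eLpNormEssSup (f := ψ) (μ := volume)] with x hx
      simpa using ENNReal.toReal_mono hfin hx
    refine gagliardoPow_lt_top_of_le (F := fun z => 2 ^ p * (gagliardoIntegrand s p ψ z +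
      (M * L) ^ p * gagliardoIntegrand s p u z))
      ((hψ.1.integrable_gagliardoIntegrand.add
        (hu.integrable_gagliardoIntegrand.const_mul _)).const_mul _) ?_
    filter_upwards [ae_prod_and hM] with z hz
    have hM0 : 0 ≤ M := (abs_nonneg _).trans hz.1
    have h1 : |ψ z.1 * f (u z.1) - ψ z.2 * f (u z.2)| ≤
        |ψ z.1 - ψ z.2| + M * L * |u z.1 - u z.2| := by
      rw [show ψ z.1 * f (u z.1) - ψ z.2 * f (u z.2) =
        (ψ z.1 - ψ z.2) * f (u z.1) +
          ψ z.2 * (f (u z.1) - f (u z.2)) by ring]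
      refine (abs_add_le _ _).trans (add_le_add ?_ ?_)
      · rw [abs_mul]
        exact mul_le_of_le_one_right (abs_nonneg _) (hf1 _)
      · rw [abs_mul, mul_assoc]
        exact mul_le_mul hz.2 (hf.dist_le_mul _ _) (abs_nonneg _) hM0
    have h2 : ∀ a b : ℝ, 0 ≤ a → 0 ≤ b → (a + b) ^ p ≤ 2 ^ p * (a ^ p + b ^ p) := by
      intro a b ha hb
      have ha' := Real.rpow_nonneg ha p
      have hb' := Real.rpow_nonneg hb p
      have hmax : max a b ^ p ≤ a ^ p + b ^ p := by
        rcases max_choice a b with h | h <;> rw [h] <;> linarith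
      refine (Real.rpow_le_rpow (add_nonneg ha hb)
        (show a + b ≤ 2 * max a b by linarith [le_max_left a b, le_max_right a b]) hp0).trans ?_
      rw [Real.mul_rpow zero_le_two (le_max_of_le_left ha)]
      gcongr
    have h3 := (Real.rpow_le_rpow (abs_nonneg _) h1 hp0).trans
      (h2 _ _ (abs_nonneg _) (by positivity))
    rw [Real.mul_rpow (by positivity) (abs_nonneg _)] at h3
    simp only [gagliardoIntegrand]
    rw [← mul_div_assoc, ← add_div, ← mul_div_assoc]
    gcongr
  · filter_upwards [hψ.2] with x hx hxΩ
    rw [hx hxΩ, zero_mul]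

end Integrability

/-! ### Testing the equation with the regularized sign -/

lemma IsFracPLaplaceWeakSolution.fracPLaplace_mul_regSign_le {N : ℕ} {s p : ℝ} (hp : 1 < p)
    {Ω : Set (EuclideanSpace ℝ (Fin N))} {g u ψ : EuclideanSpace ℝ (Fin N) → ℝ}
    (hu : IsFracPLaplaceWeakSolution s p Ω g u) (hψ : MemFracSobolevZero s p Ω ψ)
    (hψb : MemLp ψ ∞ volume) (hψ0 : ∀ᵐ x ∂volume, 0 ≤ ψ x)
    (hgψ : IntegrableOn (fun x => |g x| * ψ x) Ω volume) (n : ℕ) :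
    MemFracSobolev s p (fun x => ψ x * regSign n (u x)) ∧
      fracPLaplace s p u (fun x => ψ x * regSign n (u x)) ≤ ∫ x in Ω, |g x| * ψ x := by
  obtain ⟨hu0, ⟨C, hC⟩, heq⟩ := hu
  have hpos := hψ.mul_comp_lipschitz hp hψb hu0.1 (lipschitzWith_unitRamp n)
    (abs_unitRamp_le_one n)
  have hneg := hψ.mul_comp_lipschitz hp hψb hu0.1 (lipschitzWith_unitRamp_neg n)
    fun t => abs_unitRamp_le_one n (-t)
  have hsplit : (fun x => ψ x * regSign n (u x)) =
      fun x => ψ x * unitRamp n (u x) - ψ x * unitRamp n (-u x) := by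
    funext x
    rw [regSign, mul_sub]
  refine ⟨(hψ.mul_comp_lipschitz hp hψb hu0.1 (lipschitzWith_regSign n)
    (abs_regSign_le_one n)).1, ?_⟩
  rw [hsplit, fracPLaplace_sub hp hu0.1 hpos.1 hneg.1, heq _ hpos, heq _ hneg,
    ← integral_sub (hC _ hpos).1 (hC _ hneg).1]
  · refine integral_mono_ae ((hC _ hpos).1.sub (hC _ hneg).1) hgψ ?_
    filter_upwards [ae_restrict_of_ae hψ0] with x hx
    have h : |g x * (ψ x * regSign n (u x))| ≤ |g x| * ψ x := by
      rw [abs_mul, abs_mul, abs_of_nonneg hx]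
      exact mul_le_mul_of_nonneg_left (mul_le_of_le_one_right hx (abs_regSign_le_one n _))
        (abs_nonneg _)
    refine le_trans (le_of_eq ?_) ((le_abs_self _).trans h)
    rw [regSign]
    ring
  · filter_upwards [hψ0] with x hx using mul_nonneg hx (unitRamp_nonneg n _)
  · filter_upwards [hψ0] with x hx using mul_nonneg hx (unitRamp_nonneg n _)

theorem mainTheorem4 (N : ℕ) (hN : 1 ≤ N) (s p : ℝ) (hs0 : 0 < s) (hs1 : s < 1) (hp : 1 < p)
    (Ω : Set (EuclideanSpace ℝ (Fin N))) (hΩo : IsOpen Ω) (hΩc : IsConnected Ω)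
    (hΩb : Bornology.IsBounded Ω)
    (g u : EuclideanSpace ℝ (Fin N) → ℝ)
    (hgdual : MemFracSobolevDual s p Ω g) (hg1 : IntegrableOn g Ω volume)
    (hu : IsFracPLaplaceWeakSolution s p Ω g u) :
    MemFracSobolevZero s p Ω (fun x => |u x|) ∧
      ∀ ψ : EuclideanSpace ℝ (Fin N) → ℝ, MemFracSobolevZero s p Ω ψ → MemLp ψ ∞ volume →
        (∀ᵐ x ∂volume, 0 ≤ ψ x) →
          Integrable (fracPLaplaceIntegrand s p (fun x => |u x|) ψ) volume ∧
          IntegrableOn (fun x => |g x| * ψ x) Ω volume ∧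
          fracPLaplace s p (fun x => |u x|) ψ ≤ ∫ x in Ω, |g x| * ψ x := by
  have habs := hu.1.abs hp
  refine ⟨habs, fun ψ hψ hψb hψ0 => ?_⟩
  have hint := habs.1.integrable_fracPLaplaceIntegrand hp hψ.1
  have hgψ : IntegrableOn (fun x => |g x| * ψ x) Ω volume := by
    obtain ⟨C, hC⟩ := hgdual
    refine (hC ψ hψ).1.abs.congr ?_
    filter_upwards [ae_restrict_of_ae hψ0] with x hx
    rw [abs_mul, abs_of_nonneg hx]
  refine ⟨hint, hgψ, ?_⟩
  have htest := hu.fracPLaplace_mul_regSign_le hp hψ hψb hψ0 hgψ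
  have hintn := fun n => hu.1.1.integrable_fracPLaplaceIntegrand hp (htest n).1
  -- Both integrands are at least `-(|J_u| |ψ(x) - ψ(y)|) / |x - y|^(N + s p)`, and the second one is
  -- also at most the absolute value of this, so that their minimum is dominated.
  have hlim : Filter.Tendsto (fun n : ℕ => ∫ z,
      min (fracPLaplaceIntegrand s p u (fun x => ψ x * regSign n (u x)) z)
        (fracPLaplaceIntegrand s p (fun x => |u x|) ψ z)) Filter.atTop
      (nhds (fracPLaplace s p (fun x => |u x|) ψ)) := by
    refine tendsto_integral_of_dominated_convergence
      (fun z => gagliardoIntegrand s p u z + gagliardoIntegrand s p ψ z)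
      (fun n => ((hintn n).inf hint).aestronglyMeasurable)
      (hu.1.1.integrable_gagliardoIntegrand.add hψ.1.integrable_gagliardoIntegrand)
      (fun n => ?_) ?_
    · filter_upwards [ae_prod_and hψ0] with z hz
      have hbound := abs_signedPow_mul_div_le (s := s) hp u ψ z
      have hK : 0 ≤ ‖z.1 - z.2‖ ^ ((N : ℝ) + s * p) := Real.rpow_nonneg (norm_nonneg _) _
      have hlow : -(|signedPow p (u z.1 - u z.2)| * |ψ z.1 - ψ z.2| /
          ‖z.1 - z.2‖ ^ ((N : ℝ) + s * p)) ≤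
          fracPLaplaceIntegrand s p u (fun x => ψ x * regSign n (u x)) z := by
        rw [fracPLaplaceIntegrand_eq, ← neg_div]
        exact div_le_div_of_nonneg_right (neg_le_signedPow_mul_sub p (regSign_mono n)
          (abs_regSign_le_one n) _ _ _ hz.2) hK
      have habs' : |fracPLaplaceIntegrand s p (fun x => |u x|) ψ z| ≤
          |signedPow p (u z.1 - u z.2)| * |ψ z.1 - ψ z.2| /
          ‖z.1 - z.2‖ ^ ((N : ℝ) + s * p) := by
        rw [fracPLaplaceIntegrand_eq, abs_div, abs_mul, abs_of_nonneg hK]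
        gcongr ?_ * _ / _
        exact abs_signedPow_le hp (abs_abs_sub_abs_le_abs_sub _ _)
      have h := abs_le.1 habs'
      rw [Real.norm_eq_abs, abs_le]
      exact ⟨le_min (by linarith) (by linarith), (min_le_right _ _).trans (by linarith)⟩
    · filter_upwards [ae_prod_and hψ0] with z hz
      refine tendsto_const_nhds.congr' ?_
      filter_upwards [eventually_regSign_eq_sign (u z.1),
        eventually_regSign_eq_sign (u z.2)] with n h1 h2
      refine (min_eq_right ?_).symm
      rw [fracPLaplaceIntegrand_eq, fracPLaplaceIntegrand_eq, h1, h2]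
      exact div_le_div_of_nonneg_right (signedPow_abs_sub_abs_mul_le hp _ _ hz.1 hz.2)
        (Real.rpow_nonneg (norm_nonneg _) _)
  refine le_of_tendsto' hlim fun n => le_trans ?_ (htest n).2
  exact integral_mono ((hintn n).inf hint) (hintn n) fun z => min_le_left _ _
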